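/- Let $K$ be a field, $d\ge 0$ an integer, and $L=(\ell_1,\dots,\ell_d)$ integers with every $\ell_i\ge 1$. Let $Q$ be the grid quiver of shape $L$: its vertices are the integer points of $[0,\ell_1]\times\cdots\times[0,\ell_d]$, and there is a unique edge $p\to q$ whenever $q-p$ is a standard basis vector, and no other edge. All representations of $Q$ are finite-dimensional over $K$. For a central charge $\alpha:Q_0\to\mathbb R$, the slope of a nonzero representation $V$ is $$\mu_\alpha(V)=\frac{\sum_{x}\alpha(x)\dim V_x}{\sum_{x}\dim V_x},$$ and a nonzero representation $V$ is $\alpha$-semistable if $\mu_\alpha(V')\le\mu_\alpha(V)$ for every nonzero subrepresentation $V'\subseteq V$. The Harder–Narasimhan (HN) filtration of $V$ along $\alpha$ is the unique filtration $0=V^0\subsetneq V^1\subsetneq\cdots\subsetneq V^n=V$ whose quotients $S^i=V^i/V^{i-1}$ are $\alpha$-semistable with $\mu_\alpha(S^1)>\cdots>\mu_\alpha(S^n)$, and the HN type of $V$ along $\alpha$ is the tuple of dimension vectors $(\underline{\dim}_{S^1},\dots,\underline{\dim}_{S^n})$ (the empty tuple for $V=0$). For a rectangle $R=[a_1,b_1]\times\cdots\times[a_d,b_d]$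 with integers $0\le a_i\le b_i\le\ell_i$, the rectangle representation $\mathbf I[R]$ is $K$ at the vertices in $R$ and $0$ at the others, with identity maps along the edges inside $R$ and zero maps along all other edges. Let $\mathbf{Rep}_{\mathrm{rec}}(Q)$ be the full subcategory of those representations that are isomorphic to finite direct sums of rectangle representations, and let $\mathcal H$ be the set of all $\alpha:Q_0\to\mathbb R$ with $\mu_\alpha(\mathbf I[R])=\mu_\alpha(\mathbf I[R'])$ for some two distinct rectangles $R\ne R'$. **Theorem.** Let $\alpha:Q_0\to\mathbb R$ be a central charge with $\alpha\notin\mathcal H$. Then $\alpha$ is complete on $\mathbf{Rep}_{\mathrm{rec}}(Q)$, i.e. any two objects of $\mathbf{Rep}_{\mathrm{rec}}(Q)$ with the same HN type along $\alpha$ are isomorphic, if and only if $\alpha(s(e))>\alpha(t(e))$ for every edge $e$ of $Q$, where $s(e)$ and $t(e)$ are the source and the target of $e$. -/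

import Mathlib

universe u v w

/-! ### Finite-dimensional representations of a quiver -/

/-- A finite-dimensional representation over `K` of the quiver `Q`: a finite-dimensional vector
space at each vertex and a linear map along each edge. -/
structure QuiverRep (K : Type u) [Field K] (Q : Type w) [Quiver.{v} Q] where
  obj : Q → Type u
  [addCommGroup : ∀ x, AddCommGroup (obj x)]
  [module : ∀ x, Module K (obj x)]
  [finite : ∀ x, Module.Finite K (obj x)]
  map : ∀ {x y : Q}, (x ⟶ y) → (obj x →ₗ[K] obj y)

attribute [instance] QuiverRep.addCommGroup QuiverRep.module QuiverRep.finite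

namespace QuiverRep

section General

variable {K : Type u} [Field K] {Q : Type w} [Quiver.{v} Q]

/-- Two representations are isomorphic: there are linear isomorphisms at all vertices which
commute with the maps along all edges. -/
def IsIsomorphic (V W : QuiverRep K Q) : Prop :=
  ∃ φ : ∀ x, V.obj x ≃ₗ[K] W.obj x,
    ∀ (x y : Q) (e : x ⟶ y) (v : V.obj x), φ y (V.map e v) = W.map e (φ x v)

/-- The direct sum of a finite family of representations, computed vertex by vertex. -/
def directSum {n : ℕ} (V : Fin n → QuiverRep K Q) : QuiverRep K Q where
  obj x := ∀ i, (V i).obj x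
  map e := LinearMap.pi fun i => (V i).map e ∘ₗ LinearMap.proj i

/-- The dimension vector. -/
noncomputable def dimVec (V : QuiverRep K Q) : Q → ℕ := fun x => Module.finrank K (V.obj x)

/-- A representation is nonzero if one of its vector spaces is. -/
def IsNonzero (V : QuiverRep K Q) : Prop := ∃ x, Nontrivial (V.obj x)

/-- A subrepresentation: a subspace at each vertex, preserved by the maps along the edges. -/
@[ext]
structure Sub (V : QuiverRep K Q) where
  carrier : ∀ x, Submodule K (V.obj x)
  map_mem : ∀ {x y : Q} (e : x ⟶ y) (v : V.obj x), v ∈ carrier x → V.map e v ∈ carrier y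

/-- A subrepresentation, seen as a representation. -/
def Sub.toRep {V : QuiverRep K Q} (A : Sub V) : QuiverRep K Q where
  obj x := A.carrier x
  map {x y} e := (V.map e).restrict (p := A.carrier x) (q := A.carrier y) (A.map_mem e)

/-- The quotient of a representation by a subrepresentation. -/
def quotient (V : QuiverRep K Q) (A : Sub V) : QuiverRep K Q where
  obj x := V.obj x ⧸ A.carrier x
  map {x y} e := (A.carrier x).mapQ (A.carrier y) (V.map e) (A.map_mem e)

/-- The intersection `A ∩ B`, seen as a subrepresentation of `B`. When `A ⊆ B` this is just `A`. -/
def Sub.within {V : QuiverRep K Q} (A B : Sub V) : Sub B.toRep where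
  carrier x := (A.carrier x).comap (B.carrier x).subtype
  map_mem e v hv := A.map_mem e v.1 hv

/-- The quotient `B / A` for subrepresentations `A ⊆ B` of `V`. -/
def Sub.subquotient {V : QuiverRep K Q} (A B : Sub V) : QuiverRep K Q :=
  B.toRep.quotient (A.within B)

/-! ### Slopes, semistability and Harder-Narasimhan types -/

variable [Fintype Q]

/-- The `α`-slope of a (nonzero) representation. -/
noncomputable def slope (α : Q → ℝ) (V : QuiverRep K Q) : ℝ :=
  (∑ x, α x * (V.dimVec x : ℝ)) / (∑ x, (V.dimVec x : ℝ))

/-- `V` is `α`-semistable: it is nonzero, and no nonzero subrepresentation has a larger slope. -/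
def IsSemistable (α : Q → ℝ) (V : QuiverRep K Q) : Prop :=
  V.IsNonzero ∧ ∀ A : Sub V, A.toRep.IsNonzero → A.toRep.slope α ≤ V.slope α

/-- A Harder-Narasimhan filtration of `V` along `α`: a filtration
`0 = V⁰ ⊂ V¹ ⊂ ⋯ ⊂ Vⁿ = V` with `α`-semistable (in particular nonzero) successive quotients
of strictly decreasing slopes. The zero representation has the one of length `0`. -/
structure HNFiltration (α : Q → ℝ) (V : QuiverRep K Q) where
  length : ℕ
  step : Fin (length + 1) → Sub V
  step_zero : ∀ x, (step 0).carrier x = ⊥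
  step_last : ∀ x, (step (Fin.last length)).carrier x = ⊤
  step_le : ∀ (i : Fin length) (x : Q), (step i.castSucc).carrier x ≤ (step i.succ).carrier x
  semistable : ∀ i : Fin length, ((step i.castSucc).subquotient (step i.succ)).IsSemistable α
  slope_lt : ∀ i j : Fin length, i < j →
    ((step j.castSucc).subquotient (step j.succ)).slope α <
      ((step i.castSucc).subquotient (step i.succ)).slope α

/-- The list of dimension vectors of the successive quotients of a filtration. -/
noncomputable def HNFiltration.type {α : Q → ℝ} {V : QuiverRep K Q} (F : HNFiltration α V) :
    List (Q → ℕ) :=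
  List.ofFn fun i : Fin F.length => ((F.step i.castSucc).subquotient (F.step i.succ)).dimVec

open Classical in
/-- The Harder-Narasimhan type of `V` along `α`: the list of dimension vectors of the successive
quotients of the Harder-Narasimhan filtration (every representation has exactly one such
filtration, so the choice is no choice and the second case does not occur). -/
noncomputable def hnType (α : Q → ℝ) (V : QuiverRep K Q) : List (Q → ℕ) :=
  if h : Nonempty (HNFiltration α V) then h.some.type else []

/-- A collection `A` of central charges is complete on the full subcategory with the set of
objects `C`: objects with the same Harder-Narasimhan types along all `α ∈ A` are isomorphic. -/
def IsComplete (A : Set (Q → ℝ)) (C : Set (QuiverRep K Q)) : Prop :=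
  ∀ V ∈ C, ∀ W ∈ C, (∀ α ∈ A, V.hnType α = W.hnType α) → V.IsIsomorphic W

end General

section Indicator

variable (K : Type u) [Field K] {Q : Type w} [Quiver.{v} Q]

open Classical in
/-- The representation `I[P]` of a set `P` of vertices. Its space at `x` is the space of functions
from the proofs of `x ∈ P` to `K`, hence a copy of `K` if `x ∈ P` and zero otherwise.
Its maps are the identity of `K` on edges with both ends in `P` and zero on the other edges. -/
noncomputable def indicator (P : Set Q) : QuiverRep K Q where
  obj x := PLift (x ∈ P) → K
  map {x y} _ :=
    { toFun := fun f _ => if hx : x ∈ P then f ⟨hx⟩ else 0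
      map_add' := fun f g => by
        funext h
        by_cases hx : x ∈ P <;> simp [hx]
      map_smul' := fun c f => by
        funext h
        by_cases hx : x ∈ P <;> simp [hx] }

end Indicator

end QuiverRep

/-! ### Grid quivers and rectangles -/

/-- The vertices of the grid quiver of shape `ℓ = (ℓ₁, …, ℓ_d)`: the integer points of
`[0, ℓ₁] × ⋯ × [0, ℓ_d]`. -/
def Grid {d : ℕ} (ℓ : Fin d → ℕ) : Type := ∀ i, Fin (ℓ i + 1)

namespace Grid

section Vertices

variable {d : ℕ} {ℓ : Fin d → ℕ}

instance : Fintype (Grid ℓ) := inferInstanceAs (Fintype (∀ i, Fin (ℓ i + 1)))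

/-- There is a unique edge from `p` to `q` if `q - p` is a standard basis vector, and there is no
edge otherwise. -/
instance : Quiver.{0} (Grid ℓ) where
  Hom p q := PLift (∃ i, (q i : ℕ) = (p i : ℕ) + 1 ∧ ∀ j, j ≠ i → q j = p j)

/-- A rectangle `[a₁, b₁] × ⋯ × [a_d, b_d]`, with `aᵢ ≤ bᵢ` for all `i`, inside the grid. -/
def IsRectangle (R : Set (Grid ℓ)) : Prop :=
  ∃ a b : Grid ℓ, (∀ i, a i ≤ b i) ∧ R = {p | ∀ i, a i ≤ p i ∧ p i ≤ b i}

end Vertices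

section Representations

variable (K : Type u) [Field K] {d : ℕ} (ℓ : Fin d → ℕ)

/-- The rectangle-decomposable representations: those isomorphic to a finite direct sum of
rectangle representations `I[R]`. -/
def rectangleDecomposable : Set (QuiverRep K (Grid ℓ)) :=
  {V | ∃ (n : ℕ) (R : Fin n → Set (Grid ℓ)), (∀ i, IsRectangle (R i)) ∧
    V.IsIsomorphic (QuiverRep.directSum fun i => QuiverRep.indicator K (R i))}

/-- The union of the hyperplanes of central charges for which the rectangle representations of
two distinct rectangles have the same slope. -/
def hyperplanes : Set (Grid ℓ → ℝ) :=
  {α | ∃ R R' : Set (Grid ℓ), IsRectangle R ∧ IsRectangle R' ∧ R ≠ R' ∧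
    (QuiverRep.indicator K R).slope α = (QuiverRep.indicator K R').slope α}

end Representations

end Grid

/-! Suppose `α` decreases along the edges. A subrepresentation of `I[R]` is supported on an upper
subset of the interval `R`, so the FKG inequality bounds its slope by that of `I[R]`: rectangle
representations are semistable (`Grid.indicator_isSemistable`). The HN filtration of a sum of
semistables groups the summands by slope (`exists_hnFiltration_of_coordinates`). Off the hyperplanes
distinct rectangles have distinct slopes, so each entry of the HN type is the indicator function of
one rectangle times its multiplicity, and the type determines all multiplicities.

Conversely, let `p ⟶ q` be an edge with `α p ≤ α q`. Equality would give two singletons of the same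
slope. If `α p < α q`, then `I[{p, q}]` and `I[{p}] ⊕ I[{q}]` both have the simple at `q` followed
by the simple at `p` as HN quotients, yet only the first has a nonzero map along the edge.

Since `hnType` is defined by choice, both directions rest on the uniqueness of the HN filtration.
Its steps are characterised without reference to the filtration: each is, for some `θ`, the least
subrepresentation of maximal `(α - θ)`-weight (`HNFiltration.IsCut.isLeast`). -/

theorem Submodule.map_mkQ_comap_map_subtype_comap_mkQ {K M : Type*} [Ring K] [AddCommGroup M]
    [Module K M] {B : Submodule K M} (p : Submodule K B) (q : Submodule K (B ⧸ p)) :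
    (((q.comap p.mkQ).map B.subtype).comap B.subtype).map p.mkQ = q := by
  rw [Submodule.comap_map_eq_of_injective B.injective_subtype]
  exact Submodule.map_comap_eq_of_surjective (Submodule.mkQ_surjective _) _

/-! ### Subrepresentations and subquotients -/

namespace QuiverRep

section Subrepresentations

variable {K : Type u} [Field K] {Q : Type w} [Quiver.{v} Q] {V : QuiverRep K Q}

theorem isNonzero_iff_exists_dimVec_ne_zero : V.IsNonzero ↔ ∃ x, V.dimVec x ≠ 0 :=
  exists_congr fun _ => (Module.finrank_pos_iff.symm.trans Nat.pos_iff_ne_zero)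

namespace Sub

instance : PartialOrder (Sub V) := PartialOrder.lift carrier fun _ _ h => Sub.ext h

instance : Min (Sub V) where
  min A B :=
    { carrier := fun x => A.carrier x ⊓ B.carrier x
      map_mem := fun e v hv => ⟨A.map_mem e v hv.1, B.map_mem e v hv.2⟩ }

instance : Max (Sub V) where
  max A B :=
    { carrier := fun x => A.carrier x ⊔ B.carrier x
      map_mem := fun e v hv => by
        obtain ⟨a, ha, b, hb, rfl⟩ := Submodule.mem_sup.1 hv
        rw [map_add]
        exact Submodule.add_mem_sup (A.map_mem e a ha) (B.map_mem e b hb) }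

theorem inf_carrier (A B : Sub V) (x : Q) :
    (A ⊓ B).carrier x = A.carrier x ⊓ B.carrier x := rfl

theorem eq_of_le_of_finrank_le {A B : Sub V} (h : A ≤ B)
    (h' : ∀ x, Module.finrank K (B.carrier x) ≤ Module.finrank K (A.carrier x)) : A = B :=
  Sub.ext (funext fun x => Submodule.eq_of_le_of_finrank_le (h x) (h' x))

/-- `(X ⊓ B) ⊔ A` is the preimage of the image of `X ⊓ B` in `B / A`. It brings an arbitrary `X`
between `A` and `B`, where semistability of `B / A` applies. -/
theorem le_sup_and_sup_le {A B : Sub V} (h : A ≤ B) (X : Sub V) :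
    A ≤ (X ⊓ B) ⊔ A ∧ (X ⊓ B) ⊔ A ≤ B :=
  ⟨fun _ => le_sup_right, fun x => sup_le inf_le_right (h x)⟩

theorem toRep_dimVec (A : Sub V) (x : Q) :
    A.toRep.dimVec x = Module.finrank K (A.carrier x) := rfl

theorem within_finrank {A B : Sub V} (h : A ≤ B) (x : Q) :
    Module.finrank K ((A.within B).carrier x) = Module.finrank K (A.carrier x) :=
  (Submodule.comapSubtypeEquivOfLe (h x)).finrank_eq

theorem subquotient_dimVec_add {A B : Sub V} (h : A ≤ B) (x : Q) :
    (A.subquotient B).dimVec x + Module.finrank K (A.carrier x) =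
      Module.finrank K (B.carrier x) := by
  rw [← within_finrank h x]
  exact Submodule.finrank_quotient_add_finrank ((A.within B).carrier x)

theorem ne_of_subquotient_isNonzero {A B : Sub V} (h : (A.subquotient B).IsNonzero) : A ≠ B := by
  rintro rfl
  obtain ⟨x, hx⟩ := isNonzero_iff_exists_dimVec_ne_zero.1 h
  exact hx (by simpa using subquotient_dimVec_add (le_refl A) x)

/-- The subrepresentation `C / A` of `B / A`. -/
def relQuotient (A B C : Sub V) : Sub (A.subquotient B) where
  carrier x := ((C.within B).carrier x).map ((A.within B).carrier x).mkQ
  map_mem {x y} e v hv := by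
    obtain ⟨c, hc, rfl⟩ := hv
    exact ⟨B.toRep.map e c, (C.within B).map_mem e c hc, rfl⟩

theorem relQuotient_finrank_add {A B C : Sub V} (hA : A ≤ C) (hC : C ≤ B) (x : Q) :
    Module.finrank K ((relQuotient A B C).carrier x) + Module.finrank K (A.carrier x) =
      Module.finrank K (C.carrier x) := by
  have hle : (A.within B).carrier x ≤ (C.within B).carrier x := fun v hv => hA x hv
  rw [← within_finrank hC x, ← within_finrank (hA.trans hC) x]
  have h := LinearMap.finrank_range_add_finrank_ker
    (((A.within B).carrier x).mkQ.domRestrict ((C.within B).carrier x))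
  rw [LinearMap.range_domRestrict, LinearMap.ker_domRestrict, Submodule.ker_mkQ,
    (Submodule.comapSubtypeEquivOfLe hle).finrank_eq] at h
  exact h

/-- The preimage in `V` of a subrepresentation of `B / A`. -/
def ofRelQuotient (A B : Sub V) (D : Sub (A.subquotient B)) : Sub V where
  carrier x := ((D.carrier x).comap ((A.within B).carrier x).mkQ).map (B.carrier x).subtype
  map_mem {x y} e v hv := by
    obtain ⟨c, hc, rfl⟩ := hv
    exact ⟨B.toRep.map e c, D.map_mem e _ hc, rfl⟩

theorem ofRelQuotient_le (A B : Sub V) (D : Sub (A.subquotient B)) :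
    ofRelQuotient A B D ≤ B := fun _ => Submodule.map_subtype_le _ _

theorem le_ofRelQuotient {A B : Sub V} (h : A ≤ B) (D : Sub (A.subquotient B)) :
    A ≤ ofRelQuotient A B D := fun x a ha => by
  refine ⟨⟨a, h x ha⟩, ?_, rfl⟩
  have h0 : ((A.within B).carrier x).mkQ ⟨a, h x ha⟩ = 0 :=
    (Submodule.Quotient.mk_eq_zero _).2 ha
  have : ((A.within B).carrier x).mkQ ⟨a, h x ha⟩ ∈ D.carrier x := h0 ▸ (D.carrier x).zero_mem
  exact this

theorem ofRelQuotient_finrank {A B : Sub V} (h : A ≤ B) (D : Sub (A.subquotient B)) (x : Q) :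
    Module.finrank K ((ofRelQuotient A B D).carrier x) =
      Module.finrank K (D.carrier x) + Module.finrank K (A.carrier x) := by
  rw [← relQuotient_finrank_add (le_ofRelQuotient h D) (ofRelQuotient_le A B D) x]
  have hcarrier : (relQuotient A B (ofRelQuotient A B D)).carrier x = D.carrier x :=
    Submodule.map_mkQ_comap_map_subtype_comap_mkQ _ _
  rw [hcarrier]

end Sub

end Subrepresentations

/-! ### Weights and uniqueness of the Harder–Narasimhan filtration -/

section Weights

variable {K : Type u} [Field K] {Q : Type w} [Quiver.{v} Q] [Fintype Q] {V : QuiverRep K Q}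

theorem isNonzero_iff_sum_dimVec_pos : V.IsNonzero ↔ 0 < ∑ x, (V.dimVec x : ℝ) := by
  rw [isNonzero_iff_exists_dimVec_ne_zero,
    Finset.sum_pos_iff_of_nonneg fun x _ => Nat.cast_nonneg _]
  simp [Nat.pos_iff_ne_zero]

theorem sum_sub_mul_dimVec (α : Q → ℝ) (θ : ℝ) (V : QuiverRep K Q) :
    ∑ x, (α x - θ) * (V.dimVec x : ℝ) =
      ∑ x, α x * (V.dimVec x : ℝ) - θ * ∑ x, (V.dimVec x : ℝ) := by
  rw [Finset.mul_sum, ← Finset.sum_sub_distrib]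
  exact Finset.sum_congr rfl fun x _ => by ring

/-- Clearing the denominator replaces slopes by a weight that is linear in the dimension vector,
hence additive on subquotients. -/
theorem IsNonzero.slope_le_iff (h : V.IsNonzero) (α : Q → ℝ) (θ : ℝ) :
    V.slope α ≤ θ ↔ ∑ x, (α x - θ) * (V.dimVec x : ℝ) ≤ 0 := by
  rw [slope, div_le_iff₀ (isNonzero_iff_sum_dimVec_pos.1 h), sum_sub_mul_dimVec, sub_nonpos]

theorem IsNonzero.slope_eq_iff (h : V.IsNonzero) (α : Q → ℝ) (θ : ℝ) :
    V.slope α = θ ↔ ∑ x, (α x - θ) * (V.dimVec x : ℝ) = 0 := by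
  rw [slope, div_eq_iff (isNonzero_iff_sum_dimVec_pos.1 h).ne', sum_sub_mul_dimVec, sub_eq_zero]

/-- Every subrepresentation of a semistable representation has nonpositive weight for the
central charge shifted by the slope. -/
theorem IsSemistable.sum_sub_mul_nonpos {α : Q → ℝ} (h : V.IsSemistable α) (D : Sub V) :
    ∑ x, (α x - V.slope α) * (D.toRep.dimVec x : ℝ) ≤ 0 := by
  by_cases hD : D.toRep.IsNonzero
  · exact (hD.slope_le_iff α _).1 (h.2 D hD)
  · rw [isNonzero_iff_exists_dimVec_ne_zero] at hD
    push Not at hD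
    simp [hD]

namespace Sub

/-- The `β`-weighted dimension of a subrepresentation. -/
noncomputable def weight (β : Q → ℝ) (A : Sub V) : ℝ :=
  ∑ x, β x * (Module.finrank K (A.carrier x) : ℝ)

theorem weight_sup_add_weight_inf (β : Q → ℝ) (A B : Sub V) :
    weight β (A ⊔ B) + weight β (A ⊓ B) = weight β A + weight β B := by
  simp only [weight, ← Finset.sum_add_distrib, ← mul_add]
  refine Finset.sum_congr rfl fun x _ => ?_
  congr 1
  exact_mod_cast Submodule.finrank_sup_add_finrank_inf_eq (A.carrier x) (B.carrier x)

/-- Passes between the shift by the slope of a quotient and the shift by a cutting value; the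
correction is a multiple of the total dimension, which is monotone. -/
theorem weight_sub_eq (α : Q → ℝ) (θ μ : ℝ) (A : Sub V) :
    weight (fun x => α x - θ) A = weight (fun x => α x - μ) A + (μ - θ) * weight 1 A := by
  simp only [weight, Finset.mul_sum, ← Finset.sum_add_distrib]
  exact Finset.sum_congr rfl fun x _ => by simp only [Pi.one_apply]; ring

theorem weight_one_mono {A B : Sub V} (h : A ≤ B) : weight 1 A ≤ weight 1 B :=
  Finset.sum_le_sum fun x _ => by
    simpa using Submodule.finrank_mono (h x)

theorem eq_of_le_of_weight_one_le {A B : Sub V} (h : A ≤ B) (h' : weight 1 B ≤ weight 1 A) :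
    A = B := by
  refine eq_of_le_of_finrank_le h fun x => ?_
  have hle : ∀ x ∈ Finset.univ, (1 : Q → ℝ) x * (Module.finrank K (A.carrier x) : ℝ) ≤
      (1 : Q → ℝ) x * (Module.finrank K (B.carrier x) : ℝ) := fun x _ => by
    simpa using Submodule.finrank_mono (h x)
  have := (Finset.sum_eq_sum_iff_of_le hle).1 (le_antisymm (weight_one_mono h) h') x
    (Finset.mem_univ x)
  simp only [Pi.one_apply, one_mul, Nat.cast_inj] at this
  exact this.ge

theorem sum_mul_subquotient_dimVec {A B : Sub V} (h : A ≤ B) (β : Q → ℝ) :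
    ∑ x, β x * ((A.subquotient B).dimVec x : ℝ) = weight β B - weight β A := by
  simp only [weight, ← Finset.sum_sub_distrib, ← mul_sub]
  refine Finset.sum_congr rfl fun x _ => ?_
  rw [← subquotient_dimVec_add h x]
  push_cast
  ring

theorem sum_mul_relQuotient_dimVec {A B C : Sub V} (hA : A ≤ C) (hC : C ≤ B) (β : Q → ℝ) :
    ∑ x, β x * ((relQuotient A B C).toRep.dimVec x : ℝ) = weight β C - weight β A := by
  simp only [weight, ← Finset.sum_sub_distrib, ← mul_sub]
  refine Finset.sum_congr rfl fun x _ => ?_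
  rw [← relQuotient_finrank_add hA hC x, toRep_dimVec]
  push_cast
  ring

theorem sum_mul_dimVec_eq_weight_ofRelQuotient {A B : Sub V} (h : A ≤ B)
    (D : Sub (A.subquotient B)) (β : Q → ℝ) :
    ∑ x, β x * (D.toRep.dimVec x : ℝ) = weight β (ofRelQuotient A B D) - weight β A := by
  simp only [weight, ← Finset.sum_sub_distrib, ← mul_sub]
  refine Finset.sum_congr rfl fun x _ => ?_
  rw [ofRelQuotient_finrank h D x, toRep_dimVec]
  push_cast
  ring

theorem weight_le_of_isSemistable {A B C : Sub V} {α : Q → ℝ}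
    (h : (A.subquotient B).IsSemistable α) (hA : A ≤ C) (hC : C ≤ B) :
    weight (fun x => α x - (A.subquotient B).slope α) C ≤
      weight (fun x => α x - (A.subquotient B).slope α) A := by
  rw [← sub_nonpos, ← sum_mul_relQuotient_dimVec hA hC]
  exact h.sum_sub_mul_nonpos _

theorem weight_eq_of_isSemistable {A B : Sub V} {α : Q → ℝ} (hAB : A ≤ B)
    (h : (A.subquotient B).IsSemistable α) :
    weight (fun x => α x - (A.subquotient B).slope α) B =
      weight (fun x => α x - (A.subquotient B).slope α) A := by
  rw [← sub_eq_zero, ← sum_mul_subquotient_dimVec hAB]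
  exact (h.1.slope_eq_iff α _).1 rfl

/-- Every subrepresentation of `B / A` pulls back to some `C` between `A` and `B`, so semistability
can be tested inside `V`. -/
theorem subquotient_isSemistable_and_slope_eq {A B : Sub V} {α : Q → ℝ} {θ : ℝ} (hAB : A ≤ B)
    (hne : (A.subquotient B).IsNonzero)
    (heq : weight (fun x => α x - θ) B = weight (fun x => α x - θ) A)
    (hle : ∀ C, A ≤ C → C ≤ B → weight (fun x => α x - θ) C ≤ weight (fun x => α x - θ) A) :
    (A.subquotient B).IsSemistable α ∧ (A.subquotient B).slope α = θ := by
  have hs : (A.subquotient B).slope α = θ := by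
    rw [hne.slope_eq_iff, sum_mul_subquotient_dimVec hAB, heq, sub_self]
  refine ⟨⟨hne, fun D hD => ?_⟩, hs⟩
  rw [hs, hD.slope_le_iff, sum_mul_dimVec_eq_weight_ofRelQuotient hAB, sub_nonpos]
  exact hle _ (le_ofRelQuotient hAB D) (ofRelQuotient_le A B D)

theorem weight_inf_eq (β : Q → ℝ) {A B : Sub V} (h : A ≤ B) (X : Sub V) :
    weight β (X ⊓ B) = weight β ((X ⊓ B) ⊔ A) + weight β (X ⊓ A) - weight β A := by
  have h1 := weight_sup_add_weight_inf β (X ⊓ B) A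
  have h2 : X ⊓ B ⊓ A = X ⊓ A := Sub.ext <| funext fun x => by
    simp only [inf_carrier]
    rw [inf_assoc, inf_eq_right.2 (h x)]
  rw [h2] at h1
  linarith

/-- The difference of the two sides is the `(α - θ)`-weight of the image of `X ⊓ B` in `B / A`,
which is nonpositive because all slopes there are at most `θ`. -/
theorem weight_inf_le_of_slope_le {A B : Sub V} {α : Q → ℝ} {θ : ℝ} (hAB : A ≤ B)
    (h : (A.subquotient B).IsSemistable α) (hθ : (A.subquotient B).slope α ≤ θ) (X : Sub V) :
    weight (fun x => α x - θ) (X ⊓ B) ≤ weight (fun x => α x - θ) (X ⊓ A) := by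
  rw [weight_inf_eq _ hAB, sub_le_iff_le_add, add_comm]
  refine add_le_add_right ?_ _
  obtain ⟨h1, h2⟩ := le_sup_and_sup_le hAB X
  have := weight_le_of_isSemistable h h1 h2
  rw [weight_sub_eq α θ ((A.subquotient B).slope α), weight_sub_eq α θ ((A.subquotient B).slope α)]
  nlinarith [weight_one_mono h1]

/-- With `μ > θ` the slope of `B / A`, no subrepresentation of `B / A` has larger `(α - μ)`-weight
than `B / A` itself. Changing `μ` to `θ` adds a positive multiple of the dimension, so `B / A` is
the only maximiser. -/
theorem weight_inf_add_le_of_lt_slope {A B : Sub V} {α : Q → ℝ} {θ : ℝ} (hAB : A ≤ B)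
    (h : (A.subquotient B).IsSemistable α) (hθ : θ < (A.subquotient B).slope α) (X : Sub V) :
    weight (fun x => α x - θ) (X ⊓ B) + weight (fun x => α x - θ) A ≤
        weight (fun x => α x - θ) (X ⊓ A) + weight (fun x => α x - θ) B ∧
      (weight (fun x => α x - θ) (X ⊓ B) + weight (fun x => α x - θ) A =
        weight (fun x => α x - θ) (X ⊓ A) + weight (fun x => α x - θ) B →
          (X ⊓ B) ⊔ A = B) := by
  obtain ⟨h1, h2⟩ := le_sup_and_sup_le hAB X
  have h3 := weight_le_of_isSemistable h h1 h2
  rw [← weight_eq_of_isSemistable hAB h] at h3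
  have h4 := weight_one_mono h2
  rw [weight_inf_eq _ hAB]
  have h5 := weight_sub_eq α θ ((A.subquotient B).slope α) ((X ⊓ B) ⊔ A)
  have h6 := weight_sub_eq α θ ((A.subquotient B).slope α) B
  refine ⟨by nlinarith, fun heq => eq_of_le_of_weight_one_le h2 ?_⟩
  by_contra! hlt
  nlinarith

end Sub

namespace HNFiltration

variable {α : Q → ℝ}

/-- The slope of a successive quotient. -/
noncomputable def slopeAt (F : HNFiltration α V) (i : Fin F.length) : ℝ :=
  ((F.step i.castSucc).subquotient (F.step i.succ)).slope α

theorem slopeAt_strictAnti (F : HNFiltration α V) : StrictAnti F.slopeAt :=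
  fun i j hij => F.slope_lt i j hij

theorem castSucc_le_succ (F : HNFiltration α V) (i : Fin F.length) :
    F.step i.castSucc ≤ F.step i.succ := F.step_le i

theorem strictMono_step (F : HNFiltration α V) : StrictMono F.step :=
  Fin.strictMono_iff_lt_succ.2 fun i => lt_of_le_of_ne (F.castSucc_le_succ i)
    (Sub.ne_of_subquotient_isNonzero (F.semistable i).1)

/-- The `i`-th step separates the slopes larger than `θ` from the others. -/
def IsCut (F : HNFiltration α V) (θ : ℝ) (i : Fin (F.length + 1)) : Prop :=
  (∀ j : Fin F.length, j.castSucc < i → θ < F.slopeAt j) ∧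
    ∀ j : Fin F.length, i ≤ j.castSucc → F.slopeAt j ≤ θ

theorem exists_isCut (F : HNFiltration α V) (θ : ℝ) : ∃ i, F.IsCut θ i := by
  classical
  let s : Finset (Fin (F.length + 1)) :=
    {i | ∀ j : Fin F.length, j.castSucc < i → θ < F.slopeAt j}
  have hs : s.Nonempty := ⟨0, by simp [s]⟩
  obtain ⟨i, hm, hmax⟩ := s.exists_max_image id hs
  simp only [s, Finset.mem_filter, Finset.mem_univ, true_and, id] at hm hmax
  refine ⟨i, hm, fun j hj => ?_⟩
  by_contra! hlt
  -- If the slope at `j` exceeded `θ`, so would all earlier ones, and `j.succ` would contradict the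
  -- maximality of `i`.
  have := hmax j.succ fun k hk => by
    have hkj : k ≤ j := by
      simp only [Fin.lt_def, Fin.val_castSucc, Fin.val_succ] at hk
      exact Fin.le_def.2 (by omega)
    exact hlt.trans_le (F.slopeAt_strictAnti.antitone hkj)
  exact absurd (this.trans hj) (by simp [Fin.le_def])

theorem exists_isCut_at (F : HNFiltration α V) (i : Fin (F.length + 1)) :
    ∃ θ, F.IsCut θ i := by
  induction i using Fin.lastCases with
  | last =>
    obtain ⟨m, hm⟩ := (Set.finite_range F.slopeAt).bddBelow
    -- A cut needs `θ` strictly below all slopes, while `m` may be one of them.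
    refine ⟨m - 1, fun j _ => ?_, fun j hj => absurd hj (by simp [Fin.le_def])⟩
    linarith [hm (Set.mem_range_self j)]
  | cast i =>
    exact ⟨F.slopeAt i, fun j hj => F.slopeAt_strictAnti (by simpa using hj),
      fun j hj => F.slopeAt_strictAnti.antitone (by simpa using hj)⟩

/-- The step cutting the slopes at `θ` is the least subrepresentation of maximal weight for the
central charge `α - θ`. -/
theorem IsCut.isLeast {F : HNFiltration α V} {θ : ℝ} {i : Fin (F.length + 1)} (h : F.IsCut θ i)
    (A : Sub V) :
    A.weight (fun x => α x - θ) ≤ (F.step i).weight (fun x => α x - θ) ∧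
      (A.weight (fun x => α x - θ) = (F.step i).weight (fun x => α x - θ) → F.step i ≤ A) := by
  -- Up to `i` every quotient has slope above `θ`, so `A` reaches the weight of a step only by
  -- containing it.
  have hlow : ∀ k : Fin (F.length + 1), k ≤ i →
      (A ⊓ F.step k).weight (fun x => α x - θ) ≤ (F.step k).weight (fun x => α x - θ) ∧
      ((A ⊓ F.step k).weight (fun x => α x - θ) = (F.step k).weight (fun x => α x - θ) →
        F.step k ≤ A) := by
    intro k
    induction k using Fin.induction with
    | zero =>
      intro _
      have h0 : A ⊓ F.step 0 = F.step 0 := Sub.ext <| funext fun x => by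
        rw [Sub.inf_carrier, F.step_zero, inf_bot_eq]
      rw [h0]
      exact ⟨le_rfl, fun _ x => by rw [F.step_zero]; exact bot_le⟩
    | succ k ih =>
      intro hk
      have hk' : k.castSucc < i := lt_of_lt_of_le (by simp [Fin.lt_def]) hk
      obtain ⟨ih1, ih2⟩ := ih hk'.le
      obtain ⟨h1, h2⟩ := Sub.weight_inf_add_le_of_lt_slope (F.castSucc_le_succ k)
        (F.semistable k) (h.1 k hk') A
      refine ⟨by linarith, fun heq => ?_⟩
      have h3 := h2 (by linarith)
      have h4 := ih2 (by linarith)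
      intro x
      rw [← h3]
      exact sup_le inf_le_left (h4 x)
  -- From `i` on the quotients have slope at most `θ`, so the part of `A` beyond the step adds no
  -- weight.
  have hhigh : ∀ k : Fin (F.length + 1), i ≤ k →
      (A ⊓ F.step k).weight (fun x => α x - θ) ≤ (A ⊓ F.step i).weight (fun x => α x - θ) := by
    intro k
    induction k using Fin.induction with
    | zero => intro hk; rw [Fin.le_zero_iff.1 hk]
    | succ k ih =>
      intro hk
      rcases hk.eq_or_lt with rfl | hlt
      · exact le_rfl
      · have hk' : i ≤ k.castSucc := by
          simp only [Fin.lt_def, Fin.le_def, Fin.val_castSucc, Fin.val_succ] at hlt ⊢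
          omega
        exact (Sub.weight_inf_le_of_slope_le (F.castSucc_le_succ k) (F.semistable k)
          (h.2 k hk') A).trans (ih hk')
  have htop : A ⊓ F.step (Fin.last _) = A := Sub.ext <| funext fun x => by
    rw [Sub.inf_carrier, F.step_last, inf_top_eq]
  have h1 := hhigh _ (Fin.le_last i)
  rw [htop] at h1
  obtain ⟨h2, h3⟩ := hlow i le_rfl
  exact ⟨h1.trans h2, fun heq => h3 (le_antisymm h2 (heq ▸ h1))⟩

/-- Cutting both filtrations at the same `θ` gives two least maximisers of one weight, which
therefore agree. -/
theorem range_step_subset (F G : HNFiltration α V) : Set.range F.step ⊆ Set.range G.step := by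
  rintro _ ⟨i, rfl⟩
  obtain ⟨θ, hi⟩ := F.exists_isCut_at i
  obtain ⟨j, hj⟩ := G.exists_isCut θ
  have heq := le_antisymm (hi.isLeast (G.step j)).1 (hj.isLeast (F.step i)).1
  exact ⟨j, le_antisymm ((hj.isLeast _).2 heq.symm) ((hi.isLeast _).2 heq)⟩

/-- A representation has at most one Harder-Narasimhan filtration. -/
instance : Subsingleton (HNFiltration α V) := ⟨fun F G => by
  have hr : Set.range F.step = Set.range G.step :=
    (range_step_subset F G).antisymm (range_step_subset G F)
  have hF := F.strictMono_step
  have hG := G.strictMono_step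
  have hlen : F.length = G.length := by
    have := congrArg Set.ncard hr
    rw [Set.ncard_range_of_injective hF.injective, Set.ncard_range_of_injective hG.injective] at this
    simpa using this
  obtain ⟨n, s, _, _, _, _, _⟩ := F
  obtain ⟨m, t, _, _, _, _, _⟩ := G
  obtain rfl : n = m := hlen
  obtain rfl : s = t := (hF.range_inj hG).1 hr
  rfl⟩

theorem hnType_eq (F : HNFiltration α V) : V.hnType α = F.type := by
  have h : Nonempty (HNFiltration α V) := ⟨F⟩
  rw [hnType, dif_pos h, Subsingleton.elim h.some F]

end HNFiltration

end Weights

end QuiverRep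

/-! ### Harder–Narasimhan filtrations of direct sums -/

theorem exists_strictAnti_comp_eq {ι β : Type*} [Fintype ι] [LinearOrder β] (f : ι → β) :
    ∃ (m : ℕ) (s : Fin m → β) (r : ι → Fin m),
      StrictAnti s ∧ (∀ j, s (r j) = f j) ∧ Function.Surjective r := by
  classical
  let S : Finset β := Finset.univ.image f
  let e : Fin S.card ≃o S := S.orderIsoOfFin rfl
  refine ⟨S.card, fun i => e i.rev,
    fun j => (e.symm ⟨f j, Finset.mem_image_of_mem _ (Finset.mem_univ j)⟩).rev,
    fun i j hij => e.strictMono (Fin.rev_lt_rev.2 hij), fun j => by simp, fun i => ?_⟩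
  obtain ⟨j, _, hj⟩ := Finset.mem_image.1 (e i.rev).2
  exact ⟨j, by simp [hj]⟩

theorem LinearMap.finrank_iInf_ker_proj {K ι : Type*} [Field K] [Fintype ι] {M : ι → Type*}
    [∀ j, AddCommGroup (M j)] [∀ j, Module K (M j)] [∀ j, Module.Finite K (M j)]
    (J : Set ι) [DecidablePred (· ∈ J)] :
    Module.finrank K (⨅ j ∈ J, LinearMap.ker (LinearMap.proj j : (∀ j, M j) →ₗ[K] M j) :
      Submodule K (∀ j, M j)) = ∑ j with j ∉ J, Module.finrank K (M j) := by
  rw [(LinearMap.iInfKerProjEquiv K M (disjoint_compl_left : Disjoint Jᶜ J)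
    (Set.compl_union_self J).ge).finrank_eq, Module.finrank_pi_fintype]
  exact (Finset.sum_subtype (Finset.univ.filter fun j => j ∉ J) (by simp)
    fun j => Module.finrank K (M j)).symm

namespace QuiverRep

section DirectSums

variable {K : Type u} [Field K] {Q : Type w} [Quiver.{v} Q] {n : ℕ}

/-- Coordinates on a representation `V` which identify it with a direct sum. -/
structure Coordinates (V : QuiverRep K Q) (W : Fin n → QuiverRep K Q) where
  equiv : ∀ x, V.obj x ≃ₗ[K] ∀ j, (W j).obj x
  equiv_map : ∀ {x y : Q} (e : x ⟶ y) (v : V.obj x) (j : Fin n),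
    equiv y (V.map e v) j = (W j).map e (equiv x v j)

/-- Coordinates let the filtration be built inside `V` itself, so none has to be transported along
an isomorphism. -/
theorem IsIsomorphic.exists_coordinates {V : QuiverRep K Q} {W : Fin n → QuiverRep K Q}
    (h : V.IsIsomorphic (directSum W)) : Nonempty (Coordinates V W) := by
  obtain ⟨φ, hφ⟩ := h
  exact ⟨⟨φ, fun {x y} e v j => congrFun (hφ x y e v) j⟩⟩

namespace Coordinates

variable {V : QuiverRep K Q} {W : Fin n → QuiverRep K Q} (c : Coordinates V W)

/-- The projection to a summand. -/
def proj (j : Fin n) (x : Q) : V.obj x →ₗ[K] (W j).obj x :=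
  LinearMap.proj j ∘ₗ (c.equiv x).toLinearMap

theorem proj_map (j : Fin n) {x y : Q} (e : x ⟶ y) (v : V.obj x) :
    c.proj j y (V.map e v) = (W j).map e (c.proj j x v) := c.equiv_map e v j

/-- The subrepresentation of the vectors whose coordinates in `J` vanish. -/
def vanishing (J : Set (Fin n)) : Sub V where
  carrier x := ⨅ j ∈ J, LinearMap.ker (c.proj j x)
  map_mem e v hv := by
    simp only [Submodule.mem_iInf, LinearMap.mem_ker, proj_map] at hv ⊢
    exact fun j hj => by rw [hv j hj, map_zero]

theorem mem_vanishing {J : Set (Fin n)} {x : Q} {v : V.obj x} :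
    v ∈ (c.vanishing J).carrier x ↔ ∀ j ∈ J, c.proj j x v = 0 := by
  simp [vanishing]

theorem vanishing_anti {I J : Set (Fin n)} (h : I ⊆ J) : c.vanishing J ≤ c.vanishing I :=
  fun _ _ hv => c.mem_vanishing.2 fun j hj => c.mem_vanishing.1 hv j (h hj)

theorem vanishing_union (I J : Set (Fin n)) :
    c.vanishing (I ∪ J) = c.vanishing I ⊓ c.vanishing J :=
  Sub.ext <| funext fun x => Submodule.ext fun v => by
    rw [Sub.inf_carrier, Submodule.mem_inf]
    simp only [mem_vanishing, Set.mem_union]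
    exact ⟨fun h => ⟨fun j hj => h j (.inl hj), fun j hj => h j (.inr hj)⟩,
      fun h j hj => hj.elim (h.1 j) (h.2 j)⟩

theorem finrank_vanishing (J : Set (Fin n)) [DecidablePred (· ∈ J)] (x : Q) :
    Module.finrank K ((c.vanishing J).carrier x) = ∑ j with j ∉ J, (W j).dimVec x := by
  have h1 : (c.vanishing J).carrier x =
      (⨅ j ∈ J, LinearMap.ker (LinearMap.proj j : (∀ j, (W j).obj x) →ₗ[K] (W j).obj x)).comap
        (c.equiv x).toLinearMap := by
    ext v
    simp [mem_vanishing, proj]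
  rw [h1, ((c.equiv x).ofSubmodule' _).finrank_eq]
  exact LinearMap.finrank_iInf_ker_proj J

/-- The image of a subrepresentation in a summand. -/
def image (j : Fin n) (A : Sub V) : Sub (W j) where
  carrier x := (A.carrier x).map (c.proj j x)
  map_mem e v hv := by
    obtain ⟨a, ha, rfl⟩ := hv
    exact ⟨V.map e a, A.map_mem e a ha, c.proj_map j e a⟩

theorem finrank_image_add (j : Fin n) (A : Sub V) (x : Q) :
    Module.finrank K ((c.image j A).carrier x) +
      Module.finrank K ((A ⊓ c.vanishing {j}).carrier x) = Module.finrank K (A.carrier x) := by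
  have h := LinearMap.finrank_range_add_finrank_ker ((c.proj j x).domRestrict (A.carrier x))
  rw [LinearMap.range_domRestrict, LinearMap.ker_domRestrict] at h
  have h' : (LinearMap.ker (c.proj j x)).comap (A.carrier x).subtype =
      ((A ⊓ c.vanishing {j}).carrier x).comap (A.carrier x).subtype := by
    ext v
    simp [Sub.inf_carrier, mem_vanishing]
  have h'' := (Submodule.comapSubtypeEquivOfLe
    (show (A ⊓ c.vanishing {j}).carrier x ≤ A.carrier x from inf_le_left)).finrank_eq
  rw [h'] at h
  exact h'' ▸ h

variable [Fintype Q]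

/-- Coordinates are killed one at a time. By rank–nullity the weight lost is that of the image in `W
j`, which is nonpositive. -/
theorem weight_le_weight_inf_vanishing {β : Q → ℝ} (J : Finset (Fin n))
    (hJ : ∀ j ∈ J, ∀ D : Sub (W j), ∑ x, β x * (D.toRep.dimVec x : ℝ) ≤ 0) (A : Sub V) :
    A.weight β ≤ (A ⊓ c.vanishing (J : Set (Fin n))).weight β := by
  induction J using Finset.induction_on with
  | empty =>
    refine le_of_eq (congrArg _ (Sub.ext <| funext fun x => ?_))
    rw [Sub.inf_carrier]
    exact (inf_eq_left.2 fun v _ => c.mem_vanishing.2 (by simp)).symm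
  | insert j J _ ih =>
    refine (ih fun i hi => hJ i (Finset.mem_insert_of_mem hi)).trans ?_
    have h : A ⊓ c.vanishing ((insert j J : Finset (Fin n)) : Set (Fin n)) =
        A ⊓ c.vanishing (J : Set (Fin n)) ⊓ c.vanishing {j} := by
      rw [Finset.coe_insert, Set.insert_eq, Set.union_comm, vanishing_union]
      exact Sub.ext <| funext fun x => (inf_assoc _ _ _).symm
    rw [h]
    have hD := hJ j (Finset.mem_insert_self j J) (c.image j (A ⊓ c.vanishing (J : Set (Fin n))))
    rw [← sub_nonpos]
    refine le_of_eq_of_le ?_ hD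
    simp only [Sub.weight, ← Finset.sum_sub_distrib, ← mul_sub]
    refine Finset.sum_congr rfl fun x _ => ?_
    rw [← c.finrank_image_add j, Sub.toRep_dimVec]
    push_cast
    ring

end Coordinates

/-- The Harder-Narasimhan filtration of a direct sum of semistable representations: its quotients
are the sums of all summands of a given slope. -/
theorem exists_hnFiltration_of_coordinates [Fintype Q] {V : QuiverRep K Q}
    {W : Fin n → QuiverRep K Q} (c : Coordinates V W) {α : Q → ℝ}
    (hW : ∀ j, (W j).IsSemistable α) :
    ∃ F : HNFiltration α V, ∀ δ, δ ∈ F.type ↔ ∃ j₀, δ = fun x =>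
      ∑ j with (W j).slope α = (W j₀).slope α, (W j).dimVec x := by
  classical
  -- `s` lists the distinct slopes in decreasing order and `r j` is the position of the slope of `W
  -- j`. Step `i` will be the sum of the summands with `r j < i`.
  obtain ⟨m, s, r, hs, hr, hsurj⟩ := exists_strictAnti_comp_eq fun j => (W j).slope α
  have hrs : ∀ i j, r j = i ↔ (W j).slope α = s i := fun i j => by
    rw [← hr j, hs.injective.eq_iff]
  let step : Fin (m + 1) → Sub V := fun i => c.vanishing {j | (i : ℕ) ≤ r j}
  have hle : ∀ i : Fin m, step i.castSucc ≤ step i.succ := fun i =>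
    c.vanishing_anti fun j (hj : (i : ℕ) + 1 ≤ r j) => (Nat.le_succ _).trans hj
  have hinf : ∀ i : Fin m, step i.castSucc =
      step i.succ ⊓ c.vanishing (({j | r j = i} : Finset (Fin n)) : Set (Fin n)) := fun i => by
    rw [← c.vanishing_union]
    refine congrArg c.vanishing (Set.ext fun j => ?_)
    simp only [Set.mem_ofPred_eq, Set.mem_union, Fin.val_castSucc, Fin.val_succ,
      Finset.coe_filter, Finset.mem_univ, true_and, Fin.ext_iff]
    omega
  have hdim : ∀ (i : Fin m) x, ((step i.castSucc).subquotient (step i.succ)).dimVec x =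
      ∑ j with r j = i, (W j).dimVec x := fun i x => by
    have h := Sub.subquotient_dimVec_add (hle i) x
    rw [c.finrank_vanishing, c.finrank_vanishing] at h
    have hd : ((Finset.univ.filter fun j => j ∉ {j | ((i.succ : Fin _) : ℕ) ≤ r j}) : Finset _) =
        (Finset.univ.filter fun j => r j = i) ∪
          (Finset.univ.filter fun j => j ∉ {j | ((i.castSucc : Fin _) : ℕ) ≤ r j}) := by
      ext j
      simp only [Set.mem_ofPred_eq, Finset.mem_union, Fin.val_castSucc, Fin.val_succ,
        Finset.mem_filter, Finset.mem_univ, true_and, Fin.ext_iff]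
      omega
    rw [hd, Finset.sum_union] at h
    · exact Nat.add_right_cancel h
    · rw [Finset.disjoint_filter]
      intro j _ hj
      simp [hj]
  have hss : ∀ i : Fin m,
      ((step i.castSucc).subquotient (step i.succ)).IsSemistable α ∧
        ((step i.castSucc).subquotient (step i.succ)).slope α = s i := fun i => by
    refine Sub.subquotient_isSemistable_and_slope_eq (hle i) ?_ ?_ fun C h1 h2 => ?_
    · obtain ⟨j, hj⟩ := hsurj i
      obtain ⟨x, hx⟩ := isNonzero_iff_exists_dimVec_ne_zero.1 (hW j).1
      refine isNonzero_iff_exists_dimVec_ne_zero.2 ⟨x, fun h => hx ?_⟩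
      rw [hdim, Finset.sum_eq_zero_iff] at h
      exact h j (by simpa using hj)
    · rw [← sub_eq_zero, ← Sub.sum_mul_subquotient_dimVec (hle i)]
      simp only [hdim, Nat.cast_sum, Finset.mul_sum]
      rw [Finset.sum_comm]
      refine Finset.sum_eq_zero fun j hj => ?_
      exact ((hW j).1.slope_eq_iff α _).1 ((hrs i j).1 (by simpa using hj))
    -- Killing the coordinates of slope `s i` cuts `C` down to the lower step, and semistability of
    -- those summands shows that this does not decrease the weight.
    · have h := c.weight_le_weight_inf_vanishing (β := fun x => α x - s i) {j | r j = i}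
        (fun j hj D => by
          rw [← (hrs i j).1 (by simpa using hj)]
          exact (hW j).sum_sub_mul_nonpos D) C
      have hC : C ⊓ c.vanishing (({j | r j = i} : Finset (Fin n)) : Set (Fin n)) =
          step i.castSucc := by
        refine le_antisymm ?_ ?_
        · rw [hinf i]
          exact fun x => inf_le_inf_right _ (h2 x)
        · exact fun x => le_inf (h1 x) (by rw [hinf i]; exact inf_le_right)
      rwa [hC] at h
  refine ⟨⟨m, step, fun x => ?_, fun x => ?_, hle, fun i => (hss i).1, fun i j hij => ?_⟩,
    fun δ => ?_⟩
  · refine (Submodule.eq_bot_iff _).2 fun v hv => ?_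
    rw [c.mem_vanishing] at hv
    refine (c.equiv x).map_eq_zero_iff.1 (funext fun j => hv j ?_)
    simp
  · refine (Submodule.eq_top_iff').2 fun v => c.mem_vanishing.2 fun j hj => ?_
    simp only [Fin.val_last, Set.mem_ofPred_eq] at hj
    exact absurd (r j).2 (not_lt.2 hj)
  · rw [(hss i).2, (hss j).2]
    exact hs hij
  · simp only [HNFiltration.type, List.mem_ofFn]
    constructor
    · rintro ⟨i, rfl⟩
      obtain ⟨j₀, hj₀⟩ := hsurj i
      refine ⟨j₀, funext fun x => ?_⟩
      rw [hdim]
      simp only [hrs, ← hj₀, hr]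
    · rintro ⟨j₀, rfl⟩
      refine ⟨r j₀, funext fun x => ?_⟩
      rw [hdim]
      simp only [hrs, hr]

end DirectSums

end QuiverRep

/-! ### The FKG inequality on an interval -/

/-- The FKG inequality for a decreasing function and a relatively upper subset of an interval. -/
theorem Antitone.sum_mul_card_le_of_upper {X : Type*} [DistribLattice X] [Fintype X] {f : X → ℝ}
    (hf : Antitone f) {a b : X} {P U : Finset X} (hP : ∀ x, x ∈ P ↔ a ≤ x ∧ x ≤ b) (hUP : U ⊆ P)
    (hU : ∀ x ∈ U, ∀ y, x ≤ y → y ≤ b → y ∈ U) :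
    (∑ x ∈ U, f x) * P.card ≤ (∑ x ∈ P, f x) * U.card := by
  classical
  -- `fkg` needs nonnegative increasing functions: `C - f` is one, and the constant cancels at the
  -- end. The measure `m` is the indicator of the interval, and `g` that of the upper closure of
  -- `U`, which meets `P` in `U` only.
  obtain ⟨C, hC⟩ := (Set.finite_range f).bddAbove
  let m : X → ℝ := fun x => if x ∈ P then 1 else 0
  let g : X → ℝ := fun x => if ∃ y ∈ U, y ≤ x then 1 else 0
  have hfkg := fkg (μ := m) (f := fun x => C - f x) (g := g)
    (fun x => by dsimp only [m]; split_ifs <;> simp)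
    (fun x => sub_nonneg.2 (hC (Set.mem_range_self x)))
    (fun x => by dsimp only [g]; split_ifs <;> simp)
    (fun x y hxy => sub_le_sub_left (hf hxy) C)
    (fun x y hxy => by
      dsimp only [g]
      split_ifs with h1 h2
      · exact le_rfl
      · obtain ⟨z, hz, hzx⟩ := h1
        exact absurd ⟨z, hz, hzx.trans hxy⟩ h2
      · exact zero_le_one
      · exact le_rfl)
    (fun x y => by
      dsimp only [m]
      by_cases hx : x ∈ P
      · by_cases hy : y ∈ P
        · have h1 := (hP x).1 hx
          have h2 := (hP y).1 hy
          have h3 : x ⊓ y ∈ P := (hP _).2 ⟨le_inf h1.1 h2.1, inf_le_left.trans h1.2⟩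
          have h4 : x ⊔ y ∈ P := (hP _).2 ⟨h1.1.trans le_sup_left, sup_le h1.2 h2.2⟩
          simp [hx, hy, h3, h4]
        · rw [if_neg hy, mul_zero]
          split_ifs <;> simp
      · rw [if_neg hx, zero_mul]
        split_ifs <;> simp)
  have hm : ∀ h : X → ℝ, ∑ x, m x * h x = ∑ x ∈ P, h x := fun h => by
    simp [m, ite_mul, Finset.sum_ite_mem]
  have hg : ∀ x ∈ P, g x = if x ∈ U then 1 else 0 := fun x hx => by
    refine if_congr ⟨?_, fun h => ⟨x, h, le_rfl⟩⟩ rfl rfl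
    rintro ⟨y, hy, hyx⟩
    exact hU y hy x hyx ((hP x).1 hx).2
  have hgs : ∀ h : X → ℝ, ∑ x ∈ P, h x * g x = ∑ x ∈ U, h x := fun h => by
    rw [Finset.sum_congr rfl fun x hx => by rw [hg x hx, mul_ite, mul_one, mul_zero],
      Finset.sum_ite_mem, Finset.inter_eq_right.2 hUP]
  have h1 : ∑ x, m x = P.card := by simpa using hm fun _ => 1
  have h2 : ∑ x ∈ P, g x = U.card := by simpa using hgs fun _ => 1
  rw [hm, hm, hm, h1, h2, hgs] at hfkg
  simp only [Finset.sum_sub_distrib, Finset.sum_const, nsmul_eq_mul] at hfkg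
  linarith

/-! ### Isomorphisms, indicator representations and two-vertex supports -/

namespace QuiverRep

section Isomorphisms

variable {K : Type u} [Field K] {Q : Type w} [Quiver.{v} Q]

theorem IsIsomorphic.refl (V : QuiverRep K Q) : V.IsIsomorphic V :=
  ⟨fun _ => LinearEquiv.refl K _, fun _ _ _ _ => rfl⟩

theorem IsIsomorphic.symm {V W : QuiverRep K Q} (h : V.IsIsomorphic W) : W.IsIsomorphic V := by
  obtain ⟨φ, hφ⟩ := h
  refine ⟨fun x => (φ x).symm, fun x y e w => ?_⟩
  rw [LinearEquiv.symm_apply_eq, hφ, LinearEquiv.apply_symm_apply]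

theorem IsIsomorphic.trans {U V W : QuiverRep K Q} (h : U.IsIsomorphic V)
    (h' : V.IsIsomorphic W) : U.IsIsomorphic W := by
  obtain ⟨φ, hφ⟩ := h
  obtain ⟨ψ, hψ⟩ := h'
  refine ⟨fun x => (φ x).trans (ψ x), fun x y e w => ?_⟩
  rw [LinearEquiv.trans_apply, LinearEquiv.trans_apply, hφ, hψ]

theorem isIsomorphic_directSum_const (V : QuiverRep K Q) :
    V.IsIsomorphic (directSum fun _ : Fin 1 => V) :=
  ⟨fun x => (LinearEquiv.funUnique (Fin 1) K (V.obj x)).symm, fun _ _ _ _ => rfl⟩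

theorem directSum_indicator_isIsomorphic {n m : ℕ} {R : Fin n → Set Q} {S : Fin m → Set Q}
    (σ : Fin n ≃ Fin m) (h : ∀ j, S (σ j) = R j) :
    (directSum fun j => indicator K (R j)).IsIsomorphic (directSum fun j => indicator K (S j)) := by
  have h' : ∀ j, R (σ.symm j) = S j := fun j => by rw [← h, σ.apply_symm_apply]
  refine ⟨fun x =>
    { toFun := fun (v : ∀ j, PLift (x ∈ R j) → K) => fun (j : Fin m) (hj : PLift (x ∈ S j)) =>
        v (σ.symm j) ⟨(h' j).symm ▸ hj.down⟩
      invFun := fun (v : ∀ j, PLift (x ∈ S j) → K) => fun (j : Fin n) (hj : PLift (x ∈ R j)) =>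
        v (σ j) ⟨(h j).symm ▸ hj.down⟩
      map_add' := fun _ _ => rfl
      map_smul' := fun _ _ => rfl
      left_inv := fun (v : ∀ j, PLift (x ∈ R j) → K) => ?_
      right_inv := fun (v : ∀ j, PLift (x ∈ S j) → K) => ?_ }, fun x y e v => ?_⟩
  · have key : ∀ i j (hij : i = j) (hi : PLift (x ∈ R i)) (hj : PLift (x ∈ R j)),
        v i hi = v j hj := by
      rintro i _ rfl ⟨_⟩ ⟨_⟩
      rfl
    exact funext fun j => funext fun hj => key _ _ (σ.symm_apply_apply j) _ _
  · have key : ∀ i j (hij : i = j) (hi : PLift (x ∈ S i)) (hj : PLift (x ∈ S j)),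
        v i hi = v j hj := by
      rintro i _ rfl ⟨_⟩ ⟨_⟩
      rfl
    exact funext fun j => funext fun hj => key _ _ (σ.apply_symm_apply j) _ _
  · classical
    refine funext fun j => funext fun hj => ?_
    change (if hx : x ∈ R (σ.symm j) then v (σ.symm j) ⟨hx⟩ else 0) =
      (if hx : x ∈ S j then v (σ.symm j) ⟨(h' j).symm ▸ hx⟩ else 0)
    by_cases hx : x ∈ S j
    · rw [dif_pos hx, dif_pos ((h' j).symm ▸ hx)]
    · rw [dif_neg hx, dif_neg (h' j ▸ hx)]

end Isomorphisms

section Dimensions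

variable {K : Type u} [Field K] {Q : Type w} [Quiver.{v} Q]

theorem dimVec_directSum {n : ℕ} (V : Fin n → QuiverRep K Q) (x : Q) :
    (directSum V).dimVec x = ∑ j, (V j).dimVec x :=
  Module.finrank_pi_fintype K

theorem indicator_dimVec (P : Set Q) [DecidablePred (· ∈ P)] (x : Q) :
    (indicator K P).dimVec x = if x ∈ P then 1 else 0 := by
  change Module.finrank K (PLift (x ∈ P) → K) = _
  split_ifs with h
  · have : Unique (PLift (x ∈ P)) := ⟨⟨⟨h⟩⟩, fun ⟨_⟩ => rfl⟩
    rw [(LinearEquiv.funUnique _ K K).finrank_eq, Module.finrank_self]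
  · have : IsEmpty (PLift (x ∈ P)) := ⟨fun h' => h h'.down⟩
    exact Module.finrank_zero_of_subsingleton

theorem Sub.dimVec_le {V : QuiverRep K Q} (D : Sub V) (x : Q) :
    D.toRep.dimVec x ≤ V.dimVec x :=
  Submodule.finrank_le _

theorem indicator_map_ne_zero {P : Set Q} {x y : Q} (hy : y ∈ P) (e : x ⟶ y)
    {f : (indicator K P).obj x} (hf : f ≠ 0) : (indicator K P).map e f ≠ 0 := by
  classical
  obtain ⟨⟨hx⟩, hfx⟩ := Function.ne_iff.1 hf
  refine fun h => hfx ?_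
  have h' : (if hx : x ∈ P then f ⟨hx⟩ else 0) = (0 : K) := congrFun h ⟨hy⟩
  rwa [dif_pos hx] at h'

theorem indicator_map_eq_zero {P : Set Q} {x y : Q} (h : x ∉ P ∨ y ∉ P) (e : x ⟶ y)
    (f : (indicator K P).obj x) : (indicator K P).map e f = 0 := by
  classical
  refine funext fun hy => ?_
  change (if hx : x ∈ P then f ⟨hx⟩ else 0) = (0 : K)
  exact dif_neg (h.resolve_right (not_not_intro hy.down))

/-- The support of a subrepresentation of `I[P]` is closed under edges inside `P`. -/
theorem indicator_sub_dimVec_ne_zero {P : Set Q} (D : Sub (indicator K P)) {x y : Q}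
    (hy : y ∈ P) (e : x ⟶ y) (hx : D.toRep.dimVec x ≠ 0) : D.toRep.dimVec y ≠ 0 := by
  rw [Sub.toRep_dimVec, Ne, Submodule.finrank_eq_zero] at hx ⊢
  obtain ⟨f, hf, hf0⟩ := Submodule.exists_mem_ne_zero_of_ne_bot hx
  exact fun h => indicator_map_ne_zero hy e hf0 ((Submodule.eq_bot_iff _).1 h _ (D.map_mem e f hf))

variable [Fintype Q]

open Classical in
theorem isSemistable_of_dimVec_eq_single {V : QuiverRep K Q} {q : Q}
    (h : ∀ x, V.dimVec x = if x = q then 1 else 0) (α : Q → ℝ) :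
    V.IsSemistable α ∧ V.slope α = α q := by
  have hs : V.slope α = α q := by simp [slope, h]
  have hV : V.IsNonzero := isNonzero_iff_exists_dimVec_ne_zero.2 ⟨q, by simp [h]⟩
  refine ⟨⟨hV, fun D hD => ?_⟩, hs⟩
  have hle := D.dimVec_le
  obtain ⟨x, hx⟩ := isNonzero_iff_exists_dimVec_ne_zero.1 hD
  have hxq : x = q := by
    by_contra hne
    have := hle x
    rw [h, if_neg hne] at this
    omega
  subst hxq
  have hD' : D.toRep.dimVec = V.dimVec := funext fun y => by
    have := hle y
    rw [h] at this ⊢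
    split_ifs at this ⊢ with hy
    · subst hy; omega
    · omega
  rw [slope, slope, hD']

-- The space at `q` is a subrepresentation of larger slope whatever the map from `p` to `q` is.
-- Hence the type cannot detect that map.
open Classical in
theorem exists_hnFiltration_of_two_vertices {V : QuiverRep K Q} {p q : Q}
    (h : ∀ x, V.dimVec x = if x = p ∨ x = q then 1 else 0) (hpq : p ≠ q)
    (hqp : IsEmpty (q ⟶ p)) {α : Q → ℝ} (hα : α p < α q) :
    ∃ F : HNFiltration α V,
      F.type = [fun x => if x = q then 1 else 0, fun x => if x = p then 1 else 0] := by
  let B : Sub V := ⟨fun _ => ⊥, fun e v hv => by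
    rw [(Submodule.mem_bot K).1 hv, map_zero]; exact Submodule.zero_mem _⟩
  let T : Sub V := ⟨fun _ => ⊤, fun _ _ _ => Submodule.mem_top⟩
  -- An edge into `p` cannot start at `q`, and `A` vanishes at every other possible source.
  let A : Sub V := ⟨fun x => if x = p then ⊥ else ⊤, fun {x y} e v hv => by
    by_cases hy : y = p
    · subst hy
      rw [if_pos rfl, Submodule.mem_bot]
      by_cases hx : x = y
      · rw [if_pos hx, Submodule.mem_bot] at hv
        rw [hv, map_zero]
      · have hxq : x ≠ q := by rintro rfl; exact hqp.false e
        have h0 : V.dimVec x = 0 := by rw [h, if_neg (by tauto)]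
        have : Subsingleton (V.obj x) := Module.finrank_zero_iff.1 h0
        rw [Subsingleton.elim v 0, map_zero]
    · rw [if_neg hy]
      exact Submodule.mem_top⟩
  have hBA : B ≤ A := fun _ => bot_le
  have hAT : A ≤ T := fun _ => le_top
  have hA : ∀ x, Module.finrank K (A.carrier x) = if x = q then 1 else 0 := fun x => by
    change Module.finrank K (if x = p then ⊥ else ⊤ : Submodule K (V.obj x)) = _
    by_cases hx : x = p
    · rw [if_pos hx, if_neg (by rintro rfl; exact hpq hx.symm), finrank_bot]
    · rw [if_neg hx, finrank_top]
      exact (h x).trans (by simp [hx])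
  have h1 : ∀ x, (B.subquotient A).dimVec x = if x = q then 1 else 0 := fun x => by
    have := Sub.subquotient_dimVec_add hBA x
    rw [hA, show Module.finrank K (B.carrier x) = 0 from finrank_bot K _] at this
    exact this
  have h2 : ∀ x, (A.subquotient T).dimVec x = if x = p then 1 else 0 := fun x => by
    have := Sub.subquotient_dimVec_add hAT x
    rw [hA, show Module.finrank K (T.carrier x) = _ from (finrank_top K _).trans (h x)] at this
    by_cases hp : x = p
    · subst hp
      simpa [hpq] using this
    · rw [if_neg hp]
      by_cases hq : x = q
      · simpa [hq] using this
      · simpa [hp, hq] using this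
  obtain ⟨s1, t1⟩ := isSemistable_of_dimVec_eq_single h1 α
  obtain ⟨s2, t2⟩ := isSemistable_of_dimVec_eq_single h2 α
  refine ⟨⟨2, ![B, A, T], fun _ => rfl, fun _ => rfl, ?_, ?_, ?_⟩, ?_⟩
  · rw [Fin.forall_fin_two]
    exact ⟨hBA, hAT⟩
  · rw [Fin.forall_fin_two]
    exact ⟨s1, s2⟩
  · intro i j hij
    obtain ⟨rfl, rfl⟩ : i = 0 ∧ j = 1 := by omega
    exact (t2.trans_lt hα).trans_eq t1.symm
  · simp only [HNFiltration.type, List.ofFn_succ, List.ofFn_zero]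
    exact congrArg₂ (fun a b => [a, b]) (funext h1) (funext h2)

end Dimensions

end QuiverRep

/-! ### Rectangles in the grid and their semistability -/

namespace Grid

open QuiverRep

variable {d : ℕ} {ℓ : Fin d → ℕ}

noncomputable instance : DistribLattice (Grid ℓ) := inferInstanceAs (DistribLattice (∀ i, Fin (ℓ i + 1)))

theorem isRectangle_Icc {a b : Grid ℓ} (h : a ≤ b) : IsRectangle (Set.Icc a b) :=
  ⟨a, b, h, by ext p; exact forall_and.symm⟩

theorem IsRectangle.exists_eq_Icc {R : Set (Grid ℓ)} (h : IsRectangle R) :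
    ∃ a b : Grid ℓ, a ≤ b ∧ R = Set.Icc a b := by
  obtain ⟨a, b, hab, rfl⟩ := h
  exact ⟨a, b, hab, by ext p; exact forall_and⟩

theorem le_of_hom {p q : Grid ℓ} (e : p ⟶ q) : p ≤ q := by
  obtain ⟨⟨i, hi, h⟩⟩ := e
  refine fun j => ?_
  by_cases hj : j = i
  · subst hj
    exact Fin.le_def.2 (by omega)
  · exact (h j hj).ge

theorem ne_of_hom {p q : Grid ℓ} (e : p ⟶ q) : p ≠ q := by
  rintro rfl
  obtain ⟨⟨i, hi, _⟩⟩ := e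
  omega

/-- This makes the two ends of an edge a rectangle. -/
theorem Icc_eq_of_hom {p q : Grid ℓ} (e : p ⟶ q) : Set.Icc p q = {p, q} := by
  have hle := le_of_hom e
  obtain ⟨⟨i, hi, h⟩⟩ := e
  refine Set.Subset.antisymm (fun x hx => ?_) (Set.pair_subset ⟨le_rfl, hle⟩ ⟨hle, le_rfl⟩)
  have hj : ∀ j, j ≠ i → x j = p j := fun j hj =>
    le_antisymm ((hx.2 j).trans_eq (h j hj)) (hx.1 j)
  have h1 := Fin.le_def.1 (hx.1 i)
  have h2 := Fin.le_def.1 (hx.2 i)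
  rcases (by omega : (x i : ℕ) = p i ∨ (x i : ℕ) = q i) with h3 | h3
  · left
    funext j
    by_cases hji : j = i
    · subst hji; exact Fin.ext h3
    · exact hj j hji
  · right
    funext j
    by_cases hji : j = i
    · subst hji; exact Fin.ext h3
    · exact (hj j hji).trans (h j hji).symm

/-- Induction along a path of edges from `p` to `q`. -/
theorem induction_of_le {P : Grid ℓ → Prop} {p q : Grid ℓ} (hpq : p ≤ q)
    (h : ∀ x y, p ≤ x → y ≤ q → (x ⟶ y) → P x → P y) (hp : P p) : P q := by
  obtain ⟨n, hn⟩ : ∃ n, ∑ i, ((q i : ℕ) - p i) = n := ⟨_, rfl⟩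
  induction n using Nat.strong_induction_on generalizing p with
  | _ n ih =>
    by_cases heq : p = q
    · exact heq ▸ hp
    · obtain ⟨i, hi⟩ : ∃ i, p i ≠ q i := by
        by_contra! hall
        exact heq (funext hall)
      have hi' : (p i : ℕ) < q i := lt_of_le_of_ne (Fin.le_def.1 (hpq i)) (Fin.val_ne_of_ne hi)
      -- Raising by one a coordinate in which `p` is below `q` is an edge that stays below `q` and
      -- shortens the distance `n`.
      let r : Grid ℓ := Function.update p i ⟨p i + 1, by have := (q i).2; omega⟩
      have hri : (r i : ℕ) = p i + 1 := congrArg Fin.val (Function.update_self i _ p)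
      have hrj : ∀ j, j ≠ i → r j = p j := fun j hj => Function.update_of_ne hj _ p
      let e : p ⟶ r := ⟨i, hri, hrj⟩
      have hrq : r ≤ q := fun j => by
        by_cases hj : j = i
        · subst hj
          exact Fin.le_def.2 (by omega)
        · exact (hrj j hj).le.trans (hpq j)
      refine ih (∑ i, ((q i : ℕ) - r i)) ?_ hrq
        (fun x y hx => h x y ((le_of_hom e).trans hx)) (h p r le_rfl hrq e hp) rfl
      rw [← hn]
      refine Finset.sum_lt_sum (fun j _ => ?_) ⟨i, Finset.mem_univ i, by omega⟩
      have := Fin.le_def.1 (le_of_hom e j)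
      omega

theorem antitone_of_hom {α : Grid ℓ → ℝ} (h : ∀ (p q : Grid ℓ) (_ : p ⟶ q), α p > α q) :
    Antitone α := fun p _ hpq =>
  induction_of_le (P := fun x => α x ≤ α p) hpq
    (fun x y _ _ e hx => (h x y e).le.trans hx) le_rfl

variable (K : Type u) [Field K]

theorem indicator_isNonzero {R : Set (Grid ℓ)} (hR : IsRectangle R) :
    (indicator K R).IsNonzero := by
  classical
  obtain ⟨a, b, hab, rfl⟩ := hR.exists_eq_Icc
  exact isNonzero_iff_exists_dimVec_ne_zero.2
    ⟨a, by rw [indicator_dimVec, if_pos ⟨le_rfl, hab⟩]; exact one_ne_zero⟩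

/-- Rectangle representations are semistable along decreasing central charges. -/
theorem indicator_isSemistable {R : Set (Grid ℓ)} (hR : IsRectangle R) {α : Grid ℓ → ℝ}
    (hα : Antitone α) : (indicator K R).IsSemistable α := by
  classical
  refine ⟨indicator_isNonzero K hR, fun D hD => ?_⟩
  have hpos := isNonzero_iff_sum_dimVec_pos.1 (indicator_isNonzero K hR)
  have hposD := isNonzero_iff_sum_dimVec_pos.1 hD
  obtain ⟨a, b, hab, rfl⟩ := hR.exists_eq_Icc
  let P : Finset (Grid ℓ) := {x | x ∈ Set.Icc a b}
  let U : Finset (Grid ℓ) := {x | D.toRep.dimVec x ≠ 0}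
  have hle : ∀ x, D.toRep.dimVec x ≤ if x ∈ Set.Icc a b then 1 else 0 := fun x => by
    rw [← indicator_dimVec (K := K)]
    exact D.dimVec_le x
  have hUP : U ⊆ P := fun x hx => by
    have := hle x
    simp only [U, P, Finset.mem_filter, Finset.mem_univ, true_and] at hx ⊢
    by_contra hxP
    rw [if_neg hxP] at this
    omega
  have hdP : ∀ x, ((indicator K (Set.Icc a b)).dimVec x : ℝ) = if x ∈ P then 1 else 0 :=
    fun x => by rw [indicator_dimVec]; simp [P]
  have hdU : ∀ x, (D.toRep.dimVec x : ℝ) = if x ∈ U then 1 else 0 := fun x => by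
    have h1 : D.toRep.dimVec x ≤ 1 := (hle x).trans (by split_ifs <;> simp)
    by_cases hx : D.toRep.dimVec x = 0
    · simp [U, hx]
    · simp [U, show D.toRep.dimVec x = 1 by omega]
  -- All dimensions are at most one, so `D` is measured by its support `U`. Closure under edges,
  -- followed along a path, makes `U` an upper subset of the rectangle.
  have hfkg := hα.sum_mul_card_le_of_upper (a := a) (b := b) (P := P) (U := U)
    (fun x => by simp [P]) hUP fun x hx y hxy hyb => by
      have hax : a ≤ x := by simpa [P] using (show x ∈ Set.Icc a b by simpa [P] using hUP hx).1
      simp only [U, Finset.mem_filter, Finset.mem_univ, true_and] at hx ⊢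
      exact induction_of_le (P := fun z => D.toRep.dimVec z ≠ 0) hxy
        (fun z z' hz hz' e => indicator_sub_dimVec_ne_zero D
          ⟨(hax.trans hz).trans (le_of_hom e), hz'.trans hyb⟩ e) hx
  rw [QuiverRep.slope, QuiverRep.slope, div_le_div_iff₀ hposD hpos]
  simpa [hdP, hdU] using hfkg

end Grid

/-! ### Recovering multiplicities, and completeness -/

theorem exists_equiv_comp_eq_of_card_fiber_eq {ι κ β : Type*} [Fintype ι] [Fintype κ]
    [DecidableEq β] {f : ι → β} {g : κ → β}
    (h : ∀ b, Fintype.card {i // f i = b} = Fintype.card {k // g k = b}) :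
    ∃ σ : ι ≃ κ, ∀ i, g (σ i) = f i :=
  ⟨(Equiv.sigmaFiberEquiv f).symm.trans ((Equiv.sigmaCongrRight fun b =>
    Fintype.equivOfCardEq (h b)).trans (Equiv.sigmaFiberEquiv g)), fun i =>
      (Fintype.equivOfCardEq (h (f i)) ⟨i, rfl⟩).2⟩

namespace Grid

open QuiverRep

variable {K : Type u} [Field K] {d : ℕ} {ℓ : Fin d → ℕ}

theorem slope_indicator_inj {α : Grid ℓ → ℝ} (hα : α ∉ hyperplanes K ℓ) {R S : Set (Grid ℓ)}
    (hR : IsRectangle R) (hS : IsRectangle S) :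
    (indicator K R).slope α = (indicator K S).slope α ↔ R = S :=
  ⟨fun h => by_contra fun hne => hα ⟨R, S, hR, hS, hne, h⟩, fun h => by rw [h]⟩

-- Distinct rectangles have distinct slopes, so each HN quotient collects the copies of a single
-- rectangle.
open Classical in
theorem mem_hnType_iff {α : Grid ℓ → ℝ} (hα : α ∉ hyperplanes K ℓ) (hanti : Antitone α)
    {V : QuiverRep K (Grid ℓ)} {n : ℕ} {R : Fin n → Set (Grid ℓ)} (hR : ∀ j, IsRectangle (R j))
    (hV : V.IsIsomorphic (directSum fun j => indicator K (R j))) (δ : Grid ℓ → ℕ) :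
    δ ∈ V.hnType α ↔ ∃ j₀, δ = fun x =>
      if x ∈ R j₀ then Fintype.card {j // R j = R j₀} else 0 := by
  obtain ⟨c⟩ := hV.exists_coordinates
  obtain ⟨F, hF⟩ := exists_hnFiltration_of_coordinates c
    (fun j => indicator_isSemistable K (hR j) hanti)
  rw [F.hnType_eq, hF]
  refine exists_congr fun j₀ => ?_
  have : ∀ x, (∑ j with (indicator K (R j)).slope α = (indicator K (R j₀)).slope α,
      (indicator K (R j)).dimVec x) =
        if x ∈ R j₀ then Fintype.card {j // R j = R j₀} else 0 := fun x => by
    simp only [slope_indicator_inj hα (hR _) (hR j₀)]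
    rw [Finset.sum_congr rfl (g := fun _ => if x ∈ R j₀ then 1 else 0) fun j hj => by
      rw [indicator_dimVec, (Finset.mem_filter.1 hj).2]]
    rw [Finset.sum_const, smul_eq_mul, Fintype.card_subtype]
    split_ifs <;> simp
  simp only [this]

-- A positive multiple of the indicator function of a nonempty set determines the set, as its
-- support, and the multiple, as its value there. The order of the entries is not needed.
open Classical in
theorem card_fiber_eq_of_hnType_eq {α : Grid ℓ → ℝ} (hα : α ∉ hyperplanes K ℓ)
    (hanti : Antitone α) {V W : QuiverRep K (Grid ℓ)} {n m : ℕ} {R : Fin n → Set (Grid ℓ)}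
    {S : Fin m → Set (Grid ℓ)} (hR : ∀ j, IsRectangle (R j)) (hS : ∀ j, IsRectangle (S j))
    (hV : V.IsIsomorphic (directSum fun j => indicator K (R j)))
    (hW : W.IsIsomorphic (directSum fun j => indicator K (S j)))
    (h : V.hnType α = W.hnType α) (i : Fin n) :
    Fintype.card {j // S j = R i} = Fintype.card {j // R j = R i} := by
  obtain ⟨k, hk⟩ := (mem_hnType_iff hα hanti hS hW _).1
    (h ▸ (mem_hnType_iff hα hanti hR hV _).2 ⟨i, rfl⟩)
  have hi : 0 < Fintype.card {j // R j = R i} := Fintype.card_pos_iff.2 ⟨⟨i, rfl⟩⟩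
  have hk0 : 0 < Fintype.card {j // S j = S k} := Fintype.card_pos_iff.2 ⟨⟨k, rfl⟩⟩
  have hRS : R i = S k := by
    ext x
    have hx := congrFun hk x
    split_ifs at hx with h1 h2 h2 <;> first | omega | simp [h1, h2]
  obtain ⟨a, b, hab, hRi⟩ := (hR i).exists_eq_Icc
  have ha : a ∈ R i := hRi ▸ ⟨le_rfl, hab⟩
  have hx := congrFun hk a
  rw [if_pos ha, if_pos (hRS ▸ ha), ← hRS] at hx
  exact hx.symm

theorem isComplete_of_decreasing {α : Grid ℓ → ℝ} (hα : α ∉ hyperplanes K ℓ)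
    (h : ∀ (p q : Grid ℓ) (_ : p ⟶ q), α p > α q) :
    IsComplete {α} (rectangleDecomposable K ℓ) := by
  classical
  rintro V ⟨n, R, hR, hV⟩ W ⟨m, S, hS, hW⟩ hVW
  have hanti := antitone_of_hom h
  have htype := hVW α rfl
  have hcard : ∀ P, Fintype.card {j // R j = P} = Fintype.card {j // S j = P} := fun P => by
    by_cases hP : ∃ i, R i = P
    · obtain ⟨i, rfl⟩ := hP
      exact (card_fiber_eq_of_hnType_eq hα hanti hR hS hV hW htype i).symm
    · by_cases hP' : ∃ k, S k = P
      · obtain ⟨k, rfl⟩ := hP'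
        exact card_fiber_eq_of_hnType_eq hα hanti hS hR hW hV htype.symm k
      · push Not at hP hP'
        rw [Fintype.card_eq_zero_iff.2 ⟨fun j => hP _ j.2⟩,
          Fintype.card_eq_zero_iff.2 ⟨fun j => hP' _ j.2⟩]
  obtain ⟨σ, hσ⟩ := exists_equiv_comp_eq_of_card_fiber_eq hcard
  exact (hV.trans (directSum_indicator_isIsomorphic σ hσ)).trans hW.symm

theorem isRectangle_singleton (p : Grid ℓ) : IsRectangle {p} :=
  Set.Icc_self p ▸ isRectangle_Icc le_rfl

/-- If `α` increases along an edge, then the rectangle of its two ends has the same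
Harder-Narasimhan type as the direct sum of these ends. -/
theorem not_isComplete_of_lt {α : Grid ℓ → ℝ} {p q : Grid ℓ} (e : p ⟶ q) (h : α p < α q) :
    ¬ IsComplete {α} (rectangleDecomposable K ℓ) := by
  classical
  intro hcomplete
  have hne := ne_of_hom e
  have hqp : IsEmpty (q ⟶ p) := ⟨fun e' => hne (le_antisymm (le_of_hom e) (le_of_hom e'))⟩
  let V : QuiverRep K (Grid ℓ) := indicator K {p, q}
  let R : Fin 2 → Set (Grid ℓ) := ![{p}, {q}]
  let W : QuiverRep K (Grid ℓ) := directSum fun j => indicator K (R j)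
  have hV : V ∈ rectangleDecomposable K ℓ :=
    ⟨1, fun _ => {p, q}, fun _ => Icc_eq_of_hom e ▸ isRectangle_Icc (le_of_hom e),
      isIsomorphic_directSum_const V⟩
  have hW : W ∈ rectangleDecomposable K ℓ :=
    ⟨2, R, Fin.forall_fin_two.2 ⟨isRectangle_singleton p, isRectangle_singleton q⟩,
      IsIsomorphic.refl W⟩
  have hdV : ∀ x, V.dimVec x = if x = p ∨ x = q then 1 else 0 := fun x => by
    rw [indicator_dimVec]
    rfl
  have hdW : ∀ x, W.dimVec x = if x = p ∨ x = q then 1 else 0 := fun x => by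
    rw [dimVec_directSum, Fin.sum_univ_two, indicator_dimVec, indicator_dimVec]
    change (if x = p then 1 else 0) + (if x = q then 1 else 0) = _
    by_cases hp : x = p
    · subst hp
      simp [hne]
    · simp [hp]
  obtain ⟨F, hF⟩ := exists_hnFiltration_of_two_vertices hdV hne hqp h
  obtain ⟨G, hG⟩ := exists_hnFiltration_of_two_vertices hdW hne hqp h
  obtain ⟨φ, hφ⟩ := hcomplete V hV W hW fun β hβ => by
    obtain rfl : β = α := hβ
    rw [F.hnType_eq, G.hnType_eq, hF, hG]
  have hp0 : V.dimVec p ≠ 0 := by simp [hdV]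
  have : Nontrivial (V.obj p) := Module.finrank_pos_iff.1 (Nat.pos_of_ne_zero hp0)
  obtain ⟨v, hv⟩ := exists_ne (0 : V.obj p)
  -- The map of `V` along `e` is injective on a nonzero space, while that of `W` is zero since no
  -- summand contains both ends.
  refine indicator_map_ne_zero (P := {p, q}) (Set.mem_insert_of_mem _ rfl) e hv ?_
  refine (φ q).map_eq_zero_iff.1 ?_
  rw [hφ p q e v]
  refine funext fun j => indicator_map_eq_zero ?_ e _
  revert j
  exact Fin.forall_fin_two.2 ⟨.inr hne.symm, .inl hne⟩

end Grid

theorem theorem5p9 {K : Type*} [Field K] {d : ℕ} (ℓ : Fin d → ℕ) (hℓ : ∀ i, 1 ≤ ℓ i)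
    (α : Grid ℓ → ℝ) (hα : α ∉ Grid.hyperplanes K ℓ) :
    QuiverRep.IsComplete {α} (Grid.rectangleDecomposable K ℓ) ↔
      ∀ (p q : Grid ℓ) (_ : p ⟶ q), α p > α q := by
  classical
  refine ⟨fun h p q e => ?_, Grid.isComplete_of_decreasing hα⟩
  -- If `α p = α q`, the distinct rectangles `{p}` and `{q}` have equal slopes, against `hα`.
  refine lt_of_not_ge fun hle => Grid.not_isComplete_of_lt e (lt_of_le_of_ne hle fun heq => ?_) h
  have hs : ∀ r : Grid ℓ, (QuiverRep.indicator K {r}).slope α = α r := fun r =>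
    (QuiverRep.isSemistable_of_dimVec_eq_single (q := r)
      (fun x => by rw [QuiverRep.indicator_dimVec]; rfl) α).2
  refine Grid.ne_of_hom e (Set.singleton_injective ((Grid.slope_indicator_inj hα
    (Grid.isRectangle_singleton p) (Grid.isRectangle_singleton q)).1 ?_))
  rw [hs, hs, heq]
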